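/- Let $\mathbb{K}$ be a field of arbitrary characteristic and let $X$ be a finite non-empty quandle, i.e. a finite set with an operation $\triangleright$ such that $t\triangleright t=t$, every map $g_t\colon X\to X$, $s\mapsto t\triangleright s$, is a bijection, and $r\triangleright(s\triangleright t)=(r\triangleright s)\triangleright(r\triangleright t)$ for all $r,s,t\in X$. Let $\operatorname{Inn}X$ be the permutation group of $X$ generated by all $g_t$, and assume that $X$ is indecomposable, i.e. that $\operatorname{Inn}X$ acts transitively on $X$. Let $n=\deg X$ be the order of $g_t$, which does not depend on $t$. Let $\chi\colon X\times X\to\mathbb{K}^\times$ be a 2-cocycle, i.e. $\chi(t,s\triangleright r)\,\chi(s,r)=\chi(t\triangleright s,t\triangleright r)\,\chi(t,r)$ for all $r,s,t\in X$, and let $m=\operatorname{ord}\chi$ be the least $m\ge1$ with $\chi(t,t)^m=1$ for all $t\in X$. Let $V$ be the vector space with basis $\{e_t\}_{t\in X}$, and let $g_t$ act on the tensor algebra $TV$ as the algebra map with $g_t(e_s)=\chi(t,s)\,e_{t\triangleright s}$. Equip $TV$ with the braiding $c(u\otimes w)=g_{t_1}\cdots g_{t_k}(w)\otimes u$ for $u=e_{t_1}\cdots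 e_{t_k}$ and $w\in TV$, and with the unital comultiplication $\Delta$ for which all $e_t$ are primitive and $\Delta\mu=(\mu\otimes\mu)(\mathrm{id}\otimes c\otimes\mathrm{id})(\Delta\otimes\Delta)$, where $\mu$ is the multiplication of $TV$. Let $I$ be the largest $\mathbb{N}_0$-homogeneous two-sided ideal of $TV$ all of whose non-zero homogeneous elements have degree at least $2$ and for which $\Delta(I)\subseteq I\otimes TV+TV\otimes I$, and let $\mathfrak{B}=TV/I$ be the Nichols algebra of $(X,\chi)$. For $g\in\operatorname{Inn}X$ let $\mathfrak{B}(g)\subseteq\mathfrak{B}$ be the span of the images of all monomials $e_{t_1}\cdots e_{t_k}$ with $g_{t_1}\cdots g_{t_k}=g$. Assume that $\mathfrak{B}$ is finite-dimensional and that $n$ divides $m$. Then the $\operatorname{Inn}X$-grading of $\mathfrak{B}$ is balanced: $\mathfrak{B}=\bigoplus_{g\in\operatorname{Inn}X}\mathfrak{B}(g)$, and all the components $\mathfrak{B}(g)$ have the same (finite) dimension. Consequently $\#\operatorname{Inn}X$ divides $\dim\mathfrak{B}$. -/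

import Mathlib

open scoped Quandles TensorProduct

noncomputable section

namespace RackNichols

section Racks

variable (X : Type*) [Rack X]

/-- The inner group `Inn X`: the permutation group generated by all `g_t : s ↦ t ◃ s`. -/
def Inn : Subgroup (Equiv.Perm X) :=
  Subgroup.closure (Set.range (Rack.act' : X → Equiv.Perm X))

variable {X} in
/-- The generator `g_t` as an element of `Inn X`. -/
def innGen (t : X) : Inn X :=
  ⟨Rack.act' t, Subgroup.subset_closure (Set.mem_range_self t)⟩

/-- A rack is indecomposable if `Inn X` acts transitively on it. -/
def IsIndecomposable : Prop := MulAction.IsPretransitive (Inn X) X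

/-- The degree of `X`: the order of `g_t`, which for an indecomposable rack does not depend
on `t`, see `orderOf_innGen`. -/
def degree [Nonempty X] : ℕ := orderOf (innGen (Classical.arbitrary X))

variable {X} in
theorem innGen_smul (h : Inn X) (t : X) : innGen (h • t) = h * innGen t * h⁻¹ := by
  obtain ⟨p, hp⟩ := h
  have key : (Rack.act' (p t) : Equiv.Perm X) = p * Rack.act' t * p⁻¹ := by
    induction hp using Subgroup.closure_induction generalizing t with
    | mem x hx =>
      obtain ⟨s, rfl⟩ := hx
      exact Rack.ad_conj s t
    | one => simp
    | mul x y _ _ hx hy => rw [Equiv.Perm.mul_apply, hx, hy]; group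
    | inv x _ hx =>
      have h1 := hx (x⁻¹ t)
      have h2 : x (x⁻¹ t) = t := x.apply_symm_apply t
      rw [h2] at h1
      rw [h1]; group
  exact Subtype.ext key

variable {X} in
/-- In an indecomposable rack all the `g_t` have the same order. -/
theorem orderOf_innGen [Nonempty X] (hX : IsIndecomposable X) (t : X) :
    orderOf (innGen t) = degree X := by
  obtain ⟨h, rfl⟩ := hX.exists_smul_eq (Classical.arbitrary X) t
  rw [innGen_smul, degree]
  exact orderOf_injective (MulAut.conj h).toMonoidHom (MulAut.conj h).injective _

end Racks

section TensorAlgebra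

variable {K : Type*} [Field K] {X : Type*} [Rack X]

/-- A (rack) 2-cocycle with values in the non-zero scalars. -/
def IsCocycle (χ : X → X → Kˣ) : Prop :=
  ∀ t s r : X, χ t (s ◃ r) * χ s r = χ (t ◃ s) (t ◃ r) * χ t r

/-- The order of `χ`: the least `m ≥ 1` with `χ(t,t)^m = 1` for all `t`
(and `0` if there is no such `m`). -/
def cocycleOrder (χ : X → X → Kˣ) : ℕ := orderOf (fun t : X => χ t t)

/-- The tensor algebra `TV` of the vector space `V = K X`, i.e. the free algebra on the basis
elements `e_t = FreeAlgebra.ι K t`. -/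
abbrev TV (K : Type*) [Field K] (X : Type*) : Type _ := FreeAlgebra K X

/-- The action of `g_t` on `TV`, the algebra map with `e_s ↦ χ(t,s) e_{t ◃ s}`. -/
def gAct (χ : X → X → Kˣ) (t : X) : TV K X →ₐ[K] TV K X :=
  FreeAlgebra.lift K fun s => (χ t s : K) • FreeAlgebra.ι K (t ◃ s)

/-- The action on `TV` of a word `t₁ ⋯ t_k`, namely `g_{t₁} ∘ ⋯ ∘ g_{t_k}`. -/
def wordAct (χ : X → X → Kˣ) : FreeMonoid X →* (TV K X →ₐ[K] TV K X) :=
  FreeMonoid.lift (gAct χ)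

/-- The monomial `e_{t₁} ⋯ e_{t_k}` of a word `t₁ ⋯ t_k`. -/
def word (K : Type*) [Field K] {X : Type*} : FreeMonoid X →* TV K X :=
  FreeMonoid.lift (FreeAlgebra.ι K)

/-- The braiding on `TV ⊗ TV`: `c (u ⊗ w) = g_u(w) ⊗ u` for every monomial `u` and every `w`. -/
def braiding (χ : X → X → Kˣ) : TV K X ⊗[K] TV K X →ₗ[K] TV K X ⊗[K] TV K X :=
  TensorProduct.lift ((FreeAlgebra.basisFreeMonoid K X).constr K fun u =>
    (TensorProduct.mk K (TV K X) (TV K X)).flip (word K u) ∘ₗ (wordAct χ u).toLinearMap)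

/-- The multiplication `(μ ⊗ μ) (id ⊗ c ⊗ id)` of the braided tensor product algebra `TV ⊗ TV`. -/
def braidedMul (χ : X → X → Kˣ) :
    (TV K X ⊗[K] TV K X) ⊗[K] (TV K X ⊗[K] TV K X) →ₗ[K] TV K X ⊗[K] TV K X :=
  TensorProduct.map (LinearMap.mul' K (TV K X)) (LinearMap.mul' K (TV K X)) ∘ₗ
    (TensorProduct.assoc K (TV K X) (TV K X) (TV K X ⊗[K] TV K X)).symm.toLinearMap ∘ₗ
    LinearMap.lTensor (TV K X)
      ((TensorProduct.assoc K (TV K X) (TV K X) (TV K X)).toLinearMap ∘ₗ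
        LinearMap.rTensor (TV K X) (braiding χ) ∘ₗ
        (TensorProduct.assoc K (TV K X) (TV K X) (TV K X)).symm.toLinearMap) ∘ₗ
    (TensorProduct.assoc K (TV K X) (TV K X) (TV K X ⊗[K] TV K X)).toLinearMap

/-- Left multiplication with `e_t ⊗ 1 + 1 ⊗ e_t` in the braided tensor product algebra:
`a ⊗ b ↦ e_t a ⊗ b + g_t(a) ⊗ e_t b`. -/
def primMul (χ : X → X → Kˣ) (t : X) : Module.End K (TV K X ⊗[K] TV K X) :=
  TensorProduct.map (LinearMap.mulLeft K (FreeAlgebra.ι K t)) LinearMap.id +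
    TensorProduct.map (gAct χ t).toLinearMap (LinearMap.mulLeft K (FreeAlgebra.ι K t))

/-- The braided comultiplication `Δ` of `TV`. By `comul_one`, `comul_ι` and `comul_mul` it is the
unital map for which all `e_t` are primitive and
`Δ μ = (μ ⊗ μ) (id ⊗ c ⊗ id) (Δ ⊗ Δ)`. -/
def comul (χ : X → X → Kˣ) : TV K X →ₗ[K] TV K X ⊗[K] TV K X :=
  LinearMap.applyₗ (1 ⊗ₜ[K] 1) ∘ₗ (FreeAlgebra.lift K (primMul χ)).toLinearMap

theorem basis_eq_word {K : Type*} [Field K] {X : Type*} (u : FreeMonoid X) : FreeAlgebra.basisFreeMonoid K X u = word K u := by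
  simp [FreeAlgebra.basisFreeMonoid, word, FreeAlgebra.equivMonoidAlgebraFreeMonoid]

theorem braiding_word_tmul (χ : X → X → Kˣ) (u : FreeMonoid X) (w : TV K X) :
    braiding χ (word K u ⊗ₜ w) = wordAct χ u w ⊗ₜ word K u := by
  rw [braiding, TensorProduct.lift.tmul]
  conv_lhs => rw [← basis_eq_word]
  rw [Module.Basis.constr_basis]
  rfl

theorem braidedMul_word (χ : X → X → Kˣ) (a c d : TV K X) (u : FreeMonoid X) :
    braidedMul χ ((a ⊗ₜ word K u) ⊗ₜ (c ⊗ₜ d)) =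
      (a * wordAct χ u c) ⊗ₜ (word K u * d) := by
  simp [braidedMul, braiding_word_tmul]

theorem comul_one (χ : X → X → Kˣ) : comul χ (1 : TV K X) = 1 ⊗ₜ 1 := by
  simp [comul]

theorem comul_ι_mul (χ : X → X → Kˣ) (t : X) (x : TV K X) :
    comul χ (FreeAlgebra.ι K t * x) = primMul χ t (comul χ x) := by
  simp [comul]

theorem comul_ι (χ : X → X → Kˣ) (t : X) :
    comul χ (FreeAlgebra.ι K t) = FreeAlgebra.ι K t ⊗ₜ 1 + 1 ⊗ₜ FreeAlgebra.ι K t := by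
  simp [comul, primMul]

theorem span_word {K : Type*} [Field K] {X : Type*} : Submodule.span K (Set.range (word K : FreeMonoid X → TV K X)) = ⊤ := by
  have h : (word K : FreeMonoid X → TV K X) = FreeAlgebra.basisFreeMonoid K X :=
    funext fun u => (basis_eq_word u).symm
  rw [h]
  exact (FreeAlgebra.basisFreeMonoid K X).span_eq

theorem primMul_braidedMul (χ : X → X → Kˣ) (t : X) (A B : TV K X ⊗[K] TV K X) :
    primMul χ t (braidedMul χ (A ⊗ₜ B)) = braidedMul χ (primMul χ t A ⊗ₜ B) := by
  induction A using TensorProduct.induction_on with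
  | zero => simp
  | add x y hx hy => simp [TensorProduct.add_tmul, hx, hy]
  | tmul a b =>
    induction B using TensorProduct.induction_on with
    | zero => simp
    | add x y hx hy => simp only [TensorProduct.tmul_add, map_add, hx, hy]
    | tmul c d =>
      have hb : b ∈ Submodule.span K (Set.range (word K : FreeMonoid X → TV K X)) := by
        rw [span_word]; trivial
      induction hb using Submodule.span_induction with
      | mem x hx =>
        obtain ⟨u, rfl⟩ := hx
        have h1 : FreeAlgebra.ι K t * word K u = word K (FreeMonoid.of t * u) := by
          simp [word]
        simp only [primMul, LinearMap.add_apply, TensorProduct.map_tmul, LinearMap.mulLeft_apply,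
          LinearMap.id_apply, TensorProduct.add_tmul, map_add, braidedMul_word, h1,
          AlgHom.toLinearMap_apply]
        rw [← h1]
        simp [wordAct, mul_assoc]
      | zero => simp
      | add x y _ _ hx hy =>
        simp only [TensorProduct.tmul_add, TensorProduct.add_tmul, map_add, hx, hy]
      | smul r x _ hx =>
        simp only [TensorProduct.tmul_smul, ← TensorProduct.smul_tmul', map_smul, hx]

theorem comul_mul (χ : X → X → Kˣ) (x y : TV K X) :
    comul χ (x * y) = braidedMul χ (comul χ x ⊗ₜ comul χ y) := by
  have hx : x ∈ Submodule.span K (Set.range (word K : FreeMonoid X → TV K X)) := by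
    rw [span_word]; trivial
  induction hx using Submodule.span_induction with
  | mem x hx =>
    obtain ⟨u, rfl⟩ := hx
    induction u using FreeMonoid.inductionOn' with
    | one =>
      have h : ∀ B : TV K X ⊗[K] TV K X, braidedMul χ ((1 ⊗ₜ 1) ⊗ₜ B) = B := by
        intro B
        induction B using TensorProduct.induction_on with
        | zero => simp
        | add x y hx hy => rw [TensorProduct.tmul_add, map_add, hx, hy]
        | tmul c d => simpa using braidedMul_word χ 1 c d 1
      rw [map_one, one_mul, comul_one, h]
    | of_mul t u ih =>
      have h1 : word K (FreeMonoid.of t * u) = FreeAlgebra.ι K t * word K u := by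
        simp [word]
      rw [h1, mul_assoc, comul_ι_mul, ih, comul_ι_mul, primMul_braidedMul]
  | zero => simp
  | add x y _ _ hx hy => simp [add_mul, TensorProduct.add_tmul, hx, hy]
  | smul r x _ hx => simp [← TensorProduct.smul_tmul', hx]

/-- Given a degree map `deg` on words, the homogeneous subspace of `TV` of degree `i`, spanned by
the monomials of degree `i`. -/
def homogeneous (K : Type*) [Field K] {X ι : Type*} (deg : FreeMonoid X → ι) (i : ι) :
    Submodule K (TV K X) :=
  Submodule.span K (word K '' {u | deg u = i})

/-- The defining properties of the ideals whose largest one is divided out: `J` is a two-sided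
ideal of `TV`, it is `ℕ`-homogeneous with homogeneous elements in degrees `≥ 2` only (that is,
spanned by homogeneous elements of degree `≥ 2`), and `Δ(J) ⊆ J ⊗ TV + TV ⊗ J`. -/
structure IsNicholsIdeal (χ : X → X → Kˣ) (J : Ideal (TV K X)) : Prop where
  isTwoSided : J.IsTwoSided
  homogeneous : J.restrictScalars K ≤
    ⨆ n : ℕ, ⨆ _ : 2 ≤ n, J.restrictScalars K ⊓ homogeneous K FreeMonoid.length n
  coideal : ∀ x ∈ J, comul χ x ∈
    Submodule.map₂ (TensorProduct.mk K (TV K X) (TV K X)) (J.restrictScalars K) ⊤ ⊔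
      Submodule.map₂ (TensorProduct.mk K (TV K X) (TV K X)) ⊤ (J.restrictScalars K)

/-- The ideal `I` defining the Nichols algebra, the largest ideal as in `IsNicholsIdeal`
(see `isGreatest_nicholsIdeal`). -/
def nicholsIdeal (χ : X → X → Kˣ) : Ideal (TV K X) := sSup {J | IsNicholsIdeal χ J}

theorem nicholsIdeal_induction (χ : X → X → Kˣ) {p : TV K X → Prop}
    (mem : ∀ J : Ideal (TV K X), IsNicholsIdeal χ J → ∀ x ∈ J, p x) (zero : p 0)
    (add : ∀ x y, p x → p y → p (x + y)) {x : TV K X} (hx : x ∈ nicholsIdeal χ) : p x := by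
  rw [nicholsIdeal, sSup_eq_iSup'] at hx
  exact Submodule.iSup_induction (motive := p) _ hx (fun J => mem J.1 J.2) zero add

theorem isGreatest_nicholsIdeal (χ : X → X → Kˣ) :
    IsGreatest {J : Ideal (TV K X) | IsNicholsIdeal χ J} (nicholsIdeal χ) := by
  have hle : ∀ J : Ideal (TV K X), IsNicholsIdeal χ J →
      J.restrictScalars K ≤ (nicholsIdeal χ).restrictScalars K :=
    fun J hJ => (le_sSup hJ : J ≤ nicholsIdeal χ)
  refine ⟨⟨⟨fun b ha => ?_⟩, fun x hx => ?_, fun x hx => ?_⟩, fun J hJ => le_sSup hJ⟩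
  · refine nicholsIdeal_induction χ (p := fun x => x * b ∈ nicholsIdeal χ)
      (fun J hJ x hx => ?_) (by simp) (fun x y hx hy => ?_) ha
    · have := hJ.isTwoSided
      exact hle J hJ (J.mul_mem_right b hx)
    · rw [add_mul]; exact add_mem hx hy
  · exact nicholsIdeal_induction χ
      (fun J hJ x hx => iSup₂_mono (fun n _ => inf_le_inf_right _ (hle J hJ)) (hJ.homogeneous hx))
      (zero_mem _) (fun x y hx hy => add_mem hx hy) hx
  · refine nicholsIdeal_induction χ (p := fun x => comul χ x ∈
        Submodule.map₂ (TensorProduct.mk K (TV K X) (TV K X))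
            ((nicholsIdeal χ).restrictScalars K) ⊤ ⊔
          Submodule.map₂ (TensorProduct.mk K (TV K X) (TV K X)) ⊤
            ((nicholsIdeal χ).restrictScalars K))
      (fun J hJ x hx => ?_) (by rw [map_zero]; exact zero_mem _) (fun x y hx hy => ?_) hx
    · exact SetLike.le_def.1 (sup_le_sup (Submodule.map₂_le_map₂_left (hle J hJ))
        (Submodule.map₂_le_map₂_right (hle J hJ))) (hJ.coideal x hx)
    · rw [map_add]; exact add_mem hx hy

instance nicholsIdeal_isTwoSided (χ : X → X → Kˣ) : (nicholsIdeal χ).IsTwoSided :=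
  (isGreatest_nicholsIdeal χ).1.isTwoSided

/-- The Nichols algebra `𝔅 = TV / I` of the rack `X` and the 2-cocycle `χ`. -/
abbrev NicholsAlgebra (χ : X → X → Kˣ) : Type _ := TV K X ⧸ nicholsIdeal χ

/-- The `Inn X`-degree of a word: `t₁ ⋯ t_k` has degree `g_{t₁} ⋯ g_{t_k}`. -/
def innDegree : FreeMonoid X →* Inn X := FreeMonoid.lift innGen

/-- The `Inn X`-homogeneous component `𝔅(g)`, the image in `𝔅` of the span of all monomials of
degree `g`. -/
def nicholsComponent (χ : X → X → Kˣ) (g : Inn X) : Submodule K (NicholsAlgebra χ) :=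
  (homogeneous K innDegree g).map (Ideal.Quotient.mkₐ K (nicholsIdeal χ)).toLinearMap

end TensorAlgebra

/-- A family of subspaces `U(g)`, `g ∈ G`, is a balanced grading of `U` if `U = ⨁ U(g)` and
`dim U(g)` is finite and the same for all `g`. -/
structure IsBalancedGrading {K U G : Type*} [Field K] [AddCommGroup U] [Module K U]
    (A : G → Submodule K U) : Prop where
  iSupIndep : iSupIndep A
  iSup_eq_top : ⨆ g, A g = ⊤
  finite : ∀ g, FiniteDimensional K (A g)
  finrank_eq : ∀ g h, Module.finrank K (A g) = Module.finrank K (A h)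

end RackNichols

end

/-! Fix `t`, write `q = χ(t,t)` and `a = g_t`. On the Nichols algebra let `R` be right
multiplication by `e_t` and `D` the skew derivation `∂_t`, the contraction of `Δ` with the
coordinate of `e_t` on the right factor. They shift the `Inn X`-degree by `a` and `a⁻¹`, and `D R =
1 + q R D` (`skewDer_mul_ι`). By the cocycle identity and transitivity, `q` is a primitive `m`-th
root of unity. For `m > 1` this gives `D ^ m = 0` (`skewDer_pow_eq_zero`).

On `ker D` the operator `D ^ i R ^ i` is the scalar `[i]_q!`, non-zero for `i < m`. Hence `D ^ i`
maps the degree `g` part of `ker D ^ (i + 1)` onto the degree `g a⁻ⁱ` part of `ker D`. Summing over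
`i < m`, `dim 𝔅(g)` is the sum of the dimensions of `ker D ∩ 𝔅(g a⁻ⁱ)`. Since `n ∣ m` gives `a ^ m =
1`, this cyclic sum does not change under `g ↦ g a` (`finrank_mul_right_eq`). As the `g_t` generate
`Inn X`, all components have equal dimension.

The components form a direct sum because the defining ideal is `Inn X`-homogeneous, which follows
from its maximality (`component_mem_nicholsIdeal`). -/

noncomputable section

namespace RackNichols

/-! ### Operators with `D R = 1 + q R D`. -/

section QDeformed

variable {K B : Type*} [Field K] [AddCommGroup B] [Module K B] {q : K} {D R : Module.End K B}

/-- Moving `D` to the right past each `R` costs a factor `q` and leaves one term without `D`; these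
terms add up to the `q`-integer `[i + 1]_q`. -/
theorem lower_raise_pow (hDR : D * R = 1 + q • (R * D)) {y : B} (hy : D y = 0) (i : ℕ) :
    D ((R ^ (i + 1)) y) = (∑ j ∈ Finset.range (i + 1), q ^ j) • (R ^ i) y := by
  have key : ∀ x, D (R x) = x + q • R (D x) := fun x => by
    simpa using LinearMap.congr_fun hDR x
  induction i with
  | zero => simp [key, hy]
  | succ i ih =>
    rw [pow_succ' R (i + 1), Module.End.mul_apply, key, ih, map_smul, smul_smul,
      ← Module.End.mul_apply, ← pow_succ', Finset.sum_range_succ' _ (i + 1), Finset.mul_sum,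
      add_smul, add_comm]
    simp [pow_succ']

theorem lower_pow_raise_pow (hDR : D * R = 1 + q • (R * D)) {y : B} (hy : D y = 0) (i : ℕ) :
    (D ^ i) ((R ^ i) y) = (∏ k ∈ Finset.range i, ∑ j ∈ Finset.range (k + 1), q ^ j) • y := by
  induction i with
  | zero => simp
  | succ i ih =>
    rw [pow_succ D, Module.End.mul_apply, lower_raise_pow hDR hy, map_smul, ih, smul_smul,
      Finset.prod_range_succ, mul_comm]

/-- On a finite-dimensional space the relation `D R = 1 + q R D` with a non-zero vector in the
kernel of `D` forces `q` to be a root of unity. -/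
theorem exists_pow_eq_one_of_lower_raise [FiniteDimensional K B] (hq0 : q ≠ 0)
    (hDR : D * R = 1 + q • (R * D)) {v : B} (hv : D v = 0) (hv0 : v ≠ 0) :
    ∃ k, 0 < k ∧ q ^ k = 1 := by
  by_contra! hq
  have hsum : ∀ k, ∑ j ∈ Finset.range (k + 1), q ^ j ≠ 0 := fun k h => by
    have h1 := geom_sum_mul q (k + 1)
    rw [h, zero_mul] at h1
    exact hq (k + 1) k.succ_pos (sub_eq_zero.1 h1.symm)
  have hpow : Function.Injective fun k : ℕ => q ^ k := by
    refine Function.Injective.of_lt_imp_ne fun k l hkl h => hq (l - k) (by omega) ?_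
    have h1 : q ^ k * q ^ (l - k) = q ^ k * 1 := by
      rw [← pow_add, mul_one, h]; congr 1; omega
    exact mul_left_cancel₀ (pow_ne_zero k hq0) h1
  -- The `q`-integer determines the power of `q`, by `[k + 1]_q (q - 1) = q ^ (k + 1) - 1`.
  have hinj : Function.Injective fun k : ℕ => ∑ j ∈ Finset.range (k + 1), q ^ j := fun k l h => by
    have h1 := geom_sum_mul q (k + 1)
    have h2 := geom_sum_mul q (l + 1)
    have h3 : q ^ (k + 1) = q ^ (l + 1) := by
      rw [← sub_left_inj (a := (1 : K)), ← h1, ← h2]; exact congrArg (· * (q - 1)) h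
    exact Nat.succ_injective (hpow h3)
  have hne : ∀ k, (R ^ k) v ≠ 0 := fun k => by
    induction k with
    | zero => simpa
    | succ k ih =>
      intro h
      have h1 := lower_raise_pow hDR hv k
      rw [h, map_zero] at h1
      exact smul_ne_zero (hsum k) ih h1.symm
  -- Each `R ^ (k + 1) v` is an eigenvector of `R D` with eigenvalue `[k + 1]_q`, which is too many
  -- eigenvalues in finite dimension.
  refine (Set.infinite_range_of_injective hinj).not_finite
    ((Module.End.finite_hasEigenvalue (R * D)).subset ?_)
  rintro _ ⟨k, rfl⟩
  refine Module.End.hasEigenvalue_of_hasEigenvector (x := (R ^ (k + 1)) v)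
    ⟨Module.End.mem_eigenspace_iff.2 ?_, hne _⟩
  rw [Module.End.mul_apply, lower_raise_pow hDR hv, map_smul, pow_succ', Module.End.mul_apply]

end QDeformed

/-! ### Dimension count along the filtration by `ker D ^ i`. -/

section Shift

variable {K B G : Type*} [Field K] [AddCommGroup B] [Module K B] [FiniteDimensional K B] [Group G]
  {A : G → Submodule K B} {q : K} {D R : Module.End K B} {a : G}

/-- Rank-nullity for `D ^ i`. Surjectivity onto `ker D` in degree `g a⁻ⁱ` comes from the preimage `R
^ i y / [i]_q!`. -/
theorem finrank_inf_ker_pow_succ (hDR : D * R = 1 + q • (R * D))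
    (hD : ∀ g, ∀ x ∈ A g, D x ∈ A (g * a⁻¹)) (hR : ∀ g, ∀ x ∈ A g, R x ∈ A (g * a))
    (i : ℕ) (hi : ∀ k < i, ∑ j ∈ Finset.range (k + 1), q ^ j ≠ 0) (g : G) :
    Module.finrank K ↥(A g ⊓ LinearMap.ker (D ^ (i + 1))) =
      Module.finrank K ↥(A g ⊓ LinearMap.ker (D ^ i)) +
        Module.finrank K ↥(A (g * (a ^ i)⁻¹) ⊓ LinearMap.ker D) := by
  have hDi : ∀ n g, ∀ x ∈ A g, (D ^ n) x ∈ A (g * (a ^ n)⁻¹) := fun n => by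
    induction n with
    | zero => simp
    | succ n ih =>
      intro g x hx
      rw [pow_succ' D, Module.End.mul_apply, pow_succ' a, mul_inv_rev, ← mul_assoc]
      exact hD _ _ (ih g x hx)
  have hRi : ∀ n g, ∀ x ∈ A g, (R ^ n) x ∈ A (g * a ^ n) := fun n => by
    induction n with
    | zero => simp
    | succ n ih =>
      intro g x hx
      rw [pow_succ' R, Module.End.mul_apply, pow_succ a, ← mul_assoc]
      exact hR _ _ (ih g x hx)
  have hmap : ∀ x ∈ A g ⊓ LinearMap.ker (D ^ (i + 1)),
      (D ^ i) x ∈ A (g * (a ^ i)⁻¹) ⊓ LinearMap.ker D := fun x hx => by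
    refine ⟨hDi i g x hx.1, ?_⟩
    have := hx.2
    rwa [SetLike.mem_coe, LinearMap.mem_ker, pow_succ'] at this
  set f := (D ^ i).restrict hmap
  have hrange : LinearMap.range f = ⊤ := by
    rw [LinearMap.range_eq_top]
    rintro ⟨y, hy1, hy2⟩
    have hy2 : D y = 0 := hy2
    have h1 := lower_pow_raise_pow hDR hy2 i
    set c := ∏ k ∈ Finset.range i, ∑ j ∈ Finset.range (k + 1), q ^ j
    have hc : c ≠ 0 := Finset.prod_ne_zero_iff.2 fun k hk => hi k (Finset.mem_range.1 hk)
    have h2 : (D ^ i) (c⁻¹ • (R ^ i) y) = y := by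
      rw [map_smul, h1, smul_smul, inv_mul_cancel₀ hc, one_smul]
    refine ⟨⟨c⁻¹ • (R ^ i) y, (A g).smul_mem _ ?_, ?_⟩, Subtype.ext h2⟩
    · simpa using hRi i _ y hy1
    · change (D ^ (i + 1)) _ = 0
      rw [pow_succ', Module.End.mul_apply, h2, hy2]
  have hker : LinearMap.ker f = (A g ⊓ LinearMap.ker (D ^ i)).comap
      (A g ⊓ LinearMap.ker (D ^ (i + 1))).subtype := by
    ext ⟨x, hx⟩
    have : f ⟨x, hx⟩ = 0 ↔ (D ^ i) x = 0 := by rw [Subtype.ext_iff]; rfl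
    simpa [this] using fun _ => hx.1
  have hle : A g ⊓ LinearMap.ker (D ^ i) ≤ A g ⊓ LinearMap.ker (D ^ (i + 1)) :=
    inf_le_inf_left _ fun x hx => by
      rw [LinearMap.mem_ker] at hx ⊢
      rw [pow_succ', Module.End.mul_apply, hx, map_zero]
  rw [← LinearMap.finrank_range_add_finrank_ker f, hrange, finrank_top, hker,
    (Submodule.comapSubtypeEquivOfLe hle).finrank_eq, add_comm]

theorem finrank_mul_right_eq {m : ℕ} (hq : IsPrimitiveRoot q m)
    (hDR : D * R = 1 + q • (R * D)) (hDm : D ^ m = 0)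
    (hD : ∀ g, ∀ x ∈ A g, D x ∈ A (g * a⁻¹)) (hR : ∀ g, ∀ x ∈ A g, R x ∈ A (g * a))
    (ha : a ^ m = 1) (g : G) : Module.finrank K (A (g * a)) = Module.finrank K (A g) := by
  set φ : G → ℕ := fun h => Module.finrank K ↥(A h ⊓ LinearMap.ker D)
  have hne : ∀ k, k + 1 < m → ∑ j ∈ Finset.range (k + 1), q ^ j ≠ 0 := fun k hk h => by
    have h1 := geom_sum_mul q (k + 1)
    rw [h, zero_mul] at h1
    exact hq.pow_ne_one_of_pos_of_lt (by omega) hk (sub_eq_zero.1 h1.symm)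
  have hsum : ∀ i ≤ m, ∀ g, Module.finrank K ↥(A g ⊓ LinearMap.ker (D ^ i)) =
      ∑ j ∈ Finset.range i, φ (g * (a ^ j)⁻¹) := by
    intro i
    induction i with
    | zero =>
      intro _ g
      have : A g ⊓ LinearMap.ker (D ^ 0) = ⊥ := by
        rw [pow_zero]; exact eq_bot_iff.2 fun x hx => by simpa using hx.2
      rw [this]; simp
    | succ i ih =>
      intro hi g
      rw [finrank_inf_ker_pow_succ hDR hD hR i (fun k hk => hne k (by omega)),
        ih (by omega), Finset.sum_range_succ]
  have htot : ∀ g, Module.finrank K (A g) = ∑ j ∈ Finset.range m, φ (g * (a ^ j)⁻¹) := fun g => by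
    rw [← hsum m le_rfl, hDm, LinearMap.ker_zero, inf_top_eq]
  have hshift : ∀ j, φ (g * a * (a ^ (j + 1))⁻¹) = φ (g * (a ^ j)⁻¹) := fun j => by
    congr 1; rw [pow_succ]; group
  rw [htot (g * a), htot g, ← Finset.sum_congr rfl fun j _ => hshift j]
  -- The sum of `m + 1` terms is split off at its last and at its first term; both are `φ (g * a)`
  -- because `a ^ m = 1`.
  have h1 := Finset.sum_range_succ (fun j => φ (g * a * (a ^ j)⁻¹)) m
  rw [Finset.sum_range_succ'] at h1
  simpa [ha] using h1.symm

end Shift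

theorem finrank_eq_card_mul_finrank {K B G : Type*} [Field K] [AddCommGroup B] [Module K B]
    [FiniteDimensional K B] [Finite G] {A : G → Submodule K B} (h : IsBalancedGrading A) (g : G) :
    Module.finrank K B = Nat.card G * Module.finrank K (A g) := by
  classical
  have := Fintype.ofFinite G
  have hint := DirectSum.isInternal_submodule_of_iSupIndep_of_iSup_eq_top h.iSupIndep h.iSup_eq_top
  rw [← (LinearEquiv.ofBijective (DirectSum.coeLinearMap A) hint).finrank_eq,
    Module.finrank_directSum, Finset.sum_congr rfl fun k _ => h.finrank_eq k g]
  simp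

/-! ### Word coefficients and skew derivations of the tensor algebra. -/

section SkewDerivation

variable {K : Type*} [Field K] {X : Type*}

theorem word_of_mul (s : X) (u : FreeMonoid X) :
    word K (FreeMonoid.of s * u) = FreeAlgebra.ι K s * word K u := by
  simp [word]

theorem word_mem_homogeneous {ι : Type*} {deg : FreeMonoid X → ι} {u : FreeMonoid X} {i : ι}
    (h : deg u = i) : word K u ∈ homogeneous K deg i :=
  Submodule.subset_span ⟨u, h, rfl⟩

theorem iSup_homogeneous {ι : Type*} (deg : FreeMonoid X → ι) :
    ⨆ i, homogeneous K deg i = ⊤ := by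
  rw [eq_top_iff, ← span_word, Submodule.span_le]
  rintro _ ⟨u, rfl⟩
  exact Submodule.mem_iSup_of_mem (deg u) (word_mem_homogeneous rfl)

theorem linearMap_ext_word {M : Type*} [AddCommGroup M] [Module K M] {f g : TV K X →ₗ[K] M}
    (h : ∀ u, f (word K u) = g (word K u)) : f = g :=
  (FreeAlgebra.basisFreeMonoid K X).ext fun u => by rw [basis_eq_word]; exact h u

/-- Two linear maps on the tensor algebra agree if they agree at `1` and transform in the same way
under left multiplication with the generators. -/
theorem linearMap_ext_ι_mul {M : Type*} [AddCommGroup M] [Module K M] {f g : TV K X →ₗ[K] M}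
    (one : f 1 = g 1)
    (ι_mul : ∀ s x, f x = g x → f (FreeAlgebra.ι K s * x) = g (FreeAlgebra.ι K s * x)) :
    f = g :=
  linearMap_ext_word fun u => by
    induction u using FreeMonoid.inductionOn' with
    | one => rw [map_one, one]
    | of_mul s u ih => rw [word_of_mul]; exact ι_mul s _ ih

/-- The coefficient of a word. -/
def wordCoeff (K : Type*) [Field K] {X : Type*} (u : FreeMonoid X) : TV K X →ₗ[K] K :=
  (FreeAlgebra.basisFreeMonoid K X).coord u

theorem wordCoeff_word (u v : FreeMonoid X) [Decidable (v = u)] :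
    wordCoeff K u (word K v) = if v = u then 1 else 0 := by
  classical
  rw [wordCoeff, Module.Basis.coord_apply, ← basis_eq_word, Module.Basis.repr_self,
    Finsupp.single_apply]

theorem wordCoeff_one_one : wordCoeff K (1 : FreeMonoid X) 1 = 1 := by
  classical
  rw [← map_one (word K), wordCoeff_word, if_pos rfl]

theorem wordCoeff_of_one (t : X) : wordCoeff K (FreeMonoid.of t) 1 = 0 := by
  classical
  rw [← map_one (word K), wordCoeff_word, if_neg (FreeMonoid.one_ne_of t)]

theorem wordCoeff_one_ι_mul (s : X) (x : TV K X) :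
    wordCoeff K 1 (FreeAlgebra.ι K s * x) = 0 := by
  classical
  suffices h : wordCoeff K 1 ∘ₗ LinearMap.mulLeft K (FreeAlgebra.ι K s) = 0 from
    LinearMap.congr_fun h x
  refine linearMap_ext_word fun u => ?_
  have : FreeMonoid.of s * u ≠ 1 := fun h => by simpa using congrArg FreeMonoid.length h
  simp only [LinearMap.comp_apply, LinearMap.mulLeft_apply, ← word_of_mul, wordCoeff_word, this,
    if_false, LinearMap.zero_apply]

theorem wordCoeff_of_ι_mul [DecidableEq X] (s t : X) (x : TV K X) :
    wordCoeff K (FreeMonoid.of t) (FreeAlgebra.ι K s * x) =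
      if s = t then wordCoeff K 1 x else 0 := by
  classical
  suffices h : wordCoeff K (FreeMonoid.of t) ∘ₗ LinearMap.mulLeft K (FreeAlgebra.ι K s) =
      (if s = t then (1 : K) else 0) • wordCoeff K 1 by
    simpa only [LinearMap.comp_apply, LinearMap.mulLeft_apply, LinearMap.smul_apply, smul_eq_mul,
      ite_mul, one_mul, zero_mul] using LinearMap.congr_fun h x
  refine linearMap_ext_word fun u => ?_
  have : FreeMonoid.of s * u = FreeMonoid.of t ↔ s = t ∧ u = 1 := by
    constructor
    · intro h
      have h1 := congrArg FreeMonoid.toList h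
      simp only [FreeMonoid.toList_of_mul, FreeMonoid.toList_of, List.cons.injEq] at h1
      exact ⟨h1.1, h1.2⟩
    · rintro ⟨rfl, rfl⟩; exact mul_one _
  simp only [LinearMap.comp_apply, LinearMap.mulLeft_apply, ← word_of_mul, wordCoeff_word, this,
    LinearMap.smul_apply]
  by_cases h1 : s = t <;> simp [h1]

theorem gAct_ι [Rack X] (χ : X → X → Kˣ) (t s : X) :
    gAct χ t (FreeAlgebra.ι K s) = (χ t s : K) • FreeAlgebra.ι K (t ◃ s) := by
  simp [gAct]

/-- Contraction of the right tensor factor with a linear form. -/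
def contractRight (f : TV K X →ₗ[K] K) : TV K X ⊗[K] TV K X →ₗ[K] TV K X :=
  (TensorProduct.rid K (TV K X)).toLinearMap ∘ₗ LinearMap.lTensor (TV K X) f

theorem contractRight_tmul (f : TV K X →ₗ[K] K) (a b : TV K X) :
    contractRight f (a ⊗ₜ b) = f b • a := by
  simp [contractRight]

variable [Rack X] (χ : X → X → Kˣ)

/-- The counit axiom; it identifies the term `gAct χ t x` in the Leibniz rule `skewDer_ι_mul`. -/
theorem contractRight_wordCoeff_one_comul (x : TV K X) :
    contractRight (wordCoeff K 1) (comul χ x) = x := by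
  suffices h : contractRight (wordCoeff K 1) ∘ₗ comul χ = LinearMap.id from
    LinearMap.congr_fun h x
  refine linearMap_ext_ι_mul (by simp [comul_one, contractRight_tmul, wordCoeff_one_one])
    fun s x hx => ?_
  have key : ∀ A, contractRight (wordCoeff K 1) (primMul χ s A) =
      FreeAlgebra.ι K s * contractRight (wordCoeff K 1) A := fun A => by
    induction A using TensorProduct.induction_on with
    | zero => simp
    | add A B hA hB => simp only [map_add, mul_add, hA, hB]
    | tmul a b => simp [primMul, contractRight_tmul, wordCoeff_one_ι_mul]
  simp only [LinearMap.comp_apply, LinearMap.id_apply] at hx ⊢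
  rw [comul_ι_mul, key, hx]

/-- The skew derivation `∂_t` of the tensor algebra, with `Δ(x) = ∑ ∂_t(x) ⊗ e_t` in
`TV ⊗ V`. -/
def skewDer (t : X) : Module.End K (TV K X) :=
  contractRight (wordCoeff K (FreeMonoid.of t)) ∘ₗ comul χ

theorem skewDer_one (t : X) : skewDer χ t 1 = 0 := by
  simp [skewDer, comul_one, contractRight_tmul, wordCoeff_of_one]

theorem skewDer_ι_mul [DecidableEq X] (t s : X) (x : TV K X) :
    skewDer χ t (FreeAlgebra.ι K s * x) =
      FreeAlgebra.ι K s * skewDer χ t x + if s = t then gAct χ t x else 0 := by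
  have key : ∀ A, contractRight (wordCoeff K (FreeMonoid.of t)) (primMul χ s A) =
      FreeAlgebra.ι K s * contractRight (wordCoeff K (FreeMonoid.of t)) A +
        if s = t then gAct χ t (contractRight (wordCoeff K 1) A) else 0 := fun A => by
    induction A using TensorProduct.induction_on with
    | zero => simp
    | add A B hA hB =>
      simp only [map_add, mul_add, hA, hB]
      split_ifs <;> abel
    | tmul a b =>
      simp only [primMul, LinearMap.add_apply, TensorProduct.map_tmul, map_add,
        contractRight_tmul, LinearMap.mulLeft_apply, LinearMap.id_apply, wordCoeff_of_ι_mul,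
        mul_smul_comm, map_smul, AlgHom.toLinearMap_apply]
      split_ifs with h
      · rw [h]
      · simp
  rw [skewDer, LinearMap.comp_apply, comul_ι_mul, key, contractRight_wordCoeff_one_comul]
  rfl

end SkewDerivation

/-! ### The `q`-relations for `∂_t` in a quandle. -/

section QuandleSkewDerivation

variable {K : Type*} [Field K] {X : Type*} [Quandle X] (χ : X → X → Kˣ) (t : X)

/-- Since `g_t` fixes `t` and is injective on `X`, it moves no other generator to `e_t`, and it
scales `e_t` by `χ(t,t)`. This commutation is what allows the Leibniz rule to be iterated. -/
theorem skewDer_gAct (x : TV K X) :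
    skewDer χ t (gAct χ t x) = (χ t t : K) • gAct χ t (skewDer χ t x) := by
  classical
  suffices h : skewDer χ t ∘ₗ (gAct χ t).toLinearMap =
      (χ t t : K) • ((gAct χ t).toLinearMap ∘ₗ skewDer χ t) from LinearMap.congr_fun h x
  refine linearMap_ext_ι_mul (by simp [skewDer_one]) fun s x hx => ?_
  simp only [LinearMap.comp_apply, LinearMap.smul_apply, AlgHom.toLinearMap_apply] at hx ⊢
  have h1 : t ◃ s = t ↔ s = t := by
    conv_lhs => rhs; rw [← Quandle.fix (x := t)]
    exact Rack.left_cancel t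
  rw [map_mul, gAct_ι, smul_mul_assoc, map_smul, skewDer_ι_mul, skewDer_ι_mul, hx, map_add,
    map_mul, gAct_ι]
  simp only [h1]
  by_cases h : s = t
  · subst h
    simp [smul_add, smul_smul]
  · simp [h, smul_smul, mul_comm]

/-- The factor `χ(t,t)` arises from `g_t (x e_t) = χ(t,t) g_t (x) e_t`, which uses `t ◃ t = t`. -/
theorem skewDer_mul_ι (x : TV K X) :
    skewDer χ t (x * FreeAlgebra.ι K t) =
      x + (χ t t : K) • (skewDer χ t x * FreeAlgebra.ι K t) := by
  classical
  suffices h : skewDer χ t ∘ₗ LinearMap.mulRight K (FreeAlgebra.ι K t) =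
      LinearMap.id + (χ t t : K) • (LinearMap.mulRight K (FreeAlgebra.ι K t) ∘ₗ skewDer χ t) from
    LinearMap.congr_fun h x
  refine linearMap_ext_ι_mul ?_ fun s x hx => ?_
  · have := skewDer_ι_mul χ t t 1
    simp only [mul_one, skewDer_one, mul_zero, if_true, map_one, zero_add] at this
    simp [skewDer_one, this]
  · simp only [LinearMap.comp_apply, LinearMap.smul_apply, LinearMap.add_apply,
      LinearMap.mulRight_apply, LinearMap.id_apply] at hx ⊢
    rw [mul_assoc, skewDer_ι_mul, hx, skewDer_ι_mul, map_mul, gAct_ι, Quandle.fix]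
    by_cases h : s = t
    · simp [h, mul_add, add_mul, smul_add, mul_assoc, add_assoc]
    · simp [h, mul_add, mul_assoc]

/-- In the Leibniz rule for `∂_t ^ m` the correction term carries `[m]_q = 0`, so `∂_t ^ m` commutes
with left multiplication by every `e_s`; it also kills `1`. For `m = 1` this fails, as `[1]_q = 1`.
-/
theorem skewDer_pow_eq_zero {m : ℕ} (hq : IsPrimitiveRoot (χ t t : K) m) (hm : 1 < m) :
    skewDer χ t ^ m = 0 := by
  classical
  have key : ∀ n s x, (skewDer χ t ^ (n + 1)) (FreeAlgebra.ι K s * x) =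
      FreeAlgebra.ι K s * (skewDer χ t ^ (n + 1)) x +
        if s = t then (∑ j ∈ Finset.range (n + 1), (χ t t : K) ^ j) •
          gAct χ t ((skewDer χ t ^ n) x) else 0 := by
    intro n
    induction n with
    | zero => intro s x; simp [skewDer_ι_mul]
    | succ n ih =>
      intro s x
      rw [pow_succ', Module.End.mul_apply, ih, map_add, skewDer_ι_mul,
        ← Module.End.mul_apply, ← pow_succ', add_assoc]
      congr 1
      split_ifs with h
      · rw [map_smul, skewDer_gAct, smul_smul, ← Module.End.mul_apply, ← pow_succ',
          Finset.sum_range_succ' _ (n + 1), add_smul, Finset.sum_mul, add_comm]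
        simp [pow_succ]
      · simp
  obtain ⟨n, rfl⟩ : ∃ n, m = n + 1 := ⟨m - 1, by omega⟩
  refine linearMap_ext_ι_mul (by simp [pow_succ, skewDer_one]) fun s x hx => ?_
  rw [key, hx, hq.geom_sum_eq_zero hm]
  simp

end QuandleSkewDerivation

/-! ### Behaviour of the `Inn X`-degree under the operators. -/

section Degree

variable {K : Type*} [Field K] {X : Type*} [Rack X] (χ : X → X → Kˣ)

theorem innGen_act (t s : X) : innGen (t ◃ s) = innGen t * innGen s * (innGen t)⁻¹ :=
  innGen_smul (innGen t) s

theorem innDegree_of_mul (s : X) (u : FreeMonoid X) :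
    innDegree (FreeMonoid.of s * u) = innGen s * innDegree u := by
  simp [innDegree]

theorem ι_mul_mem_homogeneous (s : X) {g : Inn X} {x : TV K X}
    (hx : x ∈ homogeneous K innDegree g) :
    FreeAlgebra.ι K s * x ∈ homogeneous K innDegree (innGen s * g) := by
  have : homogeneous K innDegree g ≤ (homogeneous K innDegree (innGen s * g)).comap
      (LinearMap.mulLeft K (FreeAlgebra.ι K s)) := by
    refine Submodule.span_le.2 ?_
    rintro _ ⟨u, rfl, rfl⟩
    change FreeAlgebra.ι K s * word K u ∈ homogeneous K innDegree _
    rw [← word_of_mul]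
    exact word_mem_homogeneous (innDegree_of_mul s u)
  exact this hx

theorem mul_ι_mem_homogeneous (s : X) {g : Inn X} {x : TV K X}
    (hx : x ∈ homogeneous K innDegree g) :
    x * FreeAlgebra.ι K s ∈ homogeneous K innDegree (g * innGen s) := by
  have : homogeneous K innDegree g ≤ (homogeneous K innDegree (g * innGen s)).comap
      (LinearMap.mulRight K (FreeAlgebra.ι K s)) := by
    refine Submodule.span_le.2 ?_
    rintro _ ⟨u, rfl, rfl⟩
    change word K u * FreeAlgebra.ι K s ∈ homogeneous K innDegree _
    have h : word K u * FreeAlgebra.ι K s = word K (u * FreeMonoid.of s) := by simp [word]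
    rw [h]
    exact word_mem_homogeneous (by simp [innDegree])
  exact this hx

theorem gAct_word_mem_homogeneous (t : X) (u : FreeMonoid X) :
    gAct χ t (word K u) ∈
      homogeneous K innDegree (innGen t * innDegree u * (innGen t)⁻¹) := by
  induction u using FreeMonoid.inductionOn' with
  | one => simpa using word_mem_homogeneous (K := K) (map_one innDegree)
  | of_mul s u ih =>
    rw [word_of_mul, map_mul (gAct χ t), gAct_ι, smul_mul_assoc, innDegree_of_mul]
    refine Submodule.smul_mem _ _ ?_
    convert ι_mul_mem_homogeneous (t ◃ s) ih using 2
    rw [innGen_act]; group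

/-- In `∂_t (e_t x) = e_t ∂_t x + g_t (x)` the last term has the conjugated degree `g_t deg(x)
g_t⁻¹`, which is `deg(e_t x) g_t⁻¹`. -/
theorem skewDer_mem_homogeneous (t : X) {g : Inn X} {x : TV K X}
    (hx : x ∈ homogeneous K innDegree g) :
    skewDer χ t x ∈ homogeneous K innDegree (g * (innGen t)⁻¹) := by
  classical
  have : homogeneous K innDegree g ≤ (homogeneous K innDegree (g * (innGen t)⁻¹)).comap
      (skewDer χ t) := by
    refine Submodule.span_le.2 ?_
    rintro _ ⟨u, rfl, rfl⟩
    change skewDer χ t (word K u) ∈ homogeneous K innDegree _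
    clear hx
    induction u using FreeMonoid.inductionOn' with
    | one => simp [skewDer_one]
    | of_mul s u ih =>
      rw [word_of_mul, skewDer_ι_mul, innDegree_of_mul]
      refine add_mem (by simpa [mul_assoc] using ι_mul_mem_homogeneous s ih) ?_
      split_ifs with h
      · rw [h]; exact gAct_word_mem_homogeneous χ t u
      · exact zero_mem _
  exact this hx

end Degree

/-! ### Projections to homogeneous components. -/

section Component

variable {K : Type*} [Field K] {X ι : Type*} (deg : FreeMonoid X → ι)

open Classical in
/-- The projection of the tensor algebra to the homogeneous subspace of degree `i`. -/
def component (K : Type*) [Field K] {X ι : Type*} (deg : FreeMonoid X → ι) (i : ι) :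
    Module.End K (TV K X) :=
  (FreeAlgebra.basisFreeMonoid K X).constr K fun u => if deg u = i then word K u else 0

open Classical in
theorem component_word (i : ι) (u : FreeMonoid X) :
    component K deg i (word K u) = if deg u = i then word K u else 0 := by
  rw [component]
  conv_lhs => rw [← basis_eq_word]
  rw [Module.Basis.constr_basis]

variable {deg}

theorem component_of_mem {i : ι} {x : TV K X} (hx : x ∈ homogeneous K deg i) :
    component K deg i x = x := by
  classical
  have : homogeneous K deg i ≤ LinearMap.eqLocus (component K deg i) LinearMap.id := by
    refine Submodule.span_le.2 ?_
    rintro _ ⟨u, rfl, rfl⟩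
    exact (component_word deg _ u).trans (if_pos rfl)
  exact this hx

theorem component_of_mem_of_ne {i j : ι} (hij : j ≠ i) {x : TV K X}
    (hx : x ∈ homogeneous K deg j) : component K deg i x = 0 := by
  classical
  have : homogeneous K deg j ≤ LinearMap.ker (component K deg i) := by
    refine Submodule.span_le.2 ?_
    rintro _ ⟨u, rfl, rfl⟩
    exact (component_word deg _ u).trans (if_neg hij)
  exact this hx

theorem component_mem_homogeneous {κ : Type*} {deg' : FreeMonoid X → κ} (i : ι) {k : κ}
    {x : TV K X} (hx : x ∈ homogeneous K deg' k) :
    component K deg i x ∈ homogeneous K deg' k := by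
  classical
  have : homogeneous K deg' k ≤ (homogeneous K deg' k).comap (component K deg i) := by
    refine Submodule.span_le.2 ?_
    rintro _ ⟨u, rfl, rfl⟩
    change component K deg i (word K u) ∈ homogeneous K deg' _
    rw [component_word]
    split_ifs with h
    · exact word_mem_homogeneous rfl
    · exact zero_mem _
  exact this hx

theorem component_word_mul {G : Type*} [Group G] (deg : FreeMonoid X →* G) (u : FreeMonoid X)
    (g : G) (x : TV K X) :
    component K deg (deg u * g) (word K u * x) = word K u * component K deg g x := by
  classical
  suffices h : component K deg (deg u * g) ∘ₗ LinearMap.mulLeft K (word K u) =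
      LinearMap.mulLeft K (word K u) ∘ₗ component K deg g from LinearMap.congr_fun h x
  refine linearMap_ext_word fun v => ?_
  simp only [LinearMap.comp_apply, LinearMap.mulLeft_apply]
  rw [← map_mul, component_word, component_word, map_mul deg, mul_right_inj, mul_ite, mul_zero,
    map_mul]

theorem component_mul_word {G : Type*} [Group G] (deg : FreeMonoid X →* G) (u : FreeMonoid X)
    (g : G) (x : TV K X) :
    component K deg (g * deg u) (x * word K u) = component K deg g x * word K u := by
  classical
  suffices h : component K deg (g * deg u) ∘ₗ LinearMap.mulRight K (word K u) =
      LinearMap.mulRight K (word K u) ∘ₗ component K deg g from LinearMap.congr_fun h x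
  refine linearMap_ext_word fun v => ?_
  simp only [LinearMap.comp_apply, LinearMap.mulRight_apply]
  rw [← map_mul, component_word, component_word, map_mul deg, mul_left_inj, ite_mul, zero_mul,
    map_mul]

end Component

/-! ### Compatibility of `Δ` with the `Inn X`-grading. -/

section InnComponent

variable {K : Type*} [Field K] {X : Type*} [Rack X] (χ : X → X → Kˣ)

theorem component_ι_mul (s : X) (g : Inn X) (x : TV K X) :
    component K innDegree (innGen s * g) (FreeAlgebra.ι K s * x) =
      FreeAlgebra.ι K s * component K innDegree g x := by
  have := component_word_mul innDegree (FreeMonoid.of s) g x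
  simpa [innDegree, word] using this

theorem component_gAct (s : X) (g : Inn X) (x : TV K X) :
    component K innDegree (innGen s * g * (innGen s)⁻¹) (gAct χ s x) =
      gAct χ s (component K innDegree g x) := by
  classical
  suffices h : component K innDegree (innGen s * g * (innGen s)⁻¹) ∘ₗ (gAct χ s).toLinearMap =
      (gAct χ s).toLinearMap ∘ₗ component K innDegree g from LinearMap.congr_fun h x
  refine linearMap_ext_word fun v => ?_
  simp only [LinearMap.comp_apply, AlgHom.toLinearMap_apply, component_word]
  have hv := gAct_word_mem_homogeneous χ s v
  split_ifs with h
  · rw [← h, component_of_mem hv]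
  · rw [map_zero, component_of_mem_of_ne _ hv]
    simpa using h

variable [Fintype (Inn X)]

/-- The projection of `TV ⊗ TV` to the subspace of total `Inn X`-degree `g`. -/
def tensorComponent (K : Type*) [Field K] {X : Type*} [Rack X] [Fintype (Inn X)] (g : Inn X) :
    Module.End K (TV K X ⊗[K] TV K X) :=
  ∑ h, TensorProduct.map (component K innDegree h) (component K innDegree (h⁻¹ * g))

theorem tensorComponent_tmul (g : Inn X) (a b : TV K X) :
    tensorComponent K g (a ⊗ₜ b) =
      ∑ h, component K innDegree h a ⊗ₜ[K] component K innDegree (h⁻¹ * g) b := by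
  simp [tensorComponent, LinearMap.sum_apply]

theorem tensorComponent_primMul (s : X) (g : Inn X) (A : TV K X ⊗[K] TV K X) :
    tensorComponent K (innGen s * g) (primMul χ s A) =
      primMul χ s (tensorComponent K g A) := by
  induction A using TensorProduct.induction_on with
  | zero => simp
  | add A B hA hB => simp only [map_add, hA, hB]
  | tmul a b =>
    simp only [primMul, LinearMap.add_apply, TensorProduct.map_tmul, map_add,
      tensorComponent_tmul, map_sum, LinearMap.mulLeft_apply, LinearMap.id_apply,
      AlgHom.toLinearMap_apply, Finset.sum_add_distrib]
    congr 1
    · refine (Fintype.sum_equiv (Equiv.mulLeft (innGen s)) _ _ fun h => ?_).symm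
      rw [Equiv.coe_mulLeft, component_ι_mul]
      congr 3; group
    · refine (Fintype.sum_equiv (MulAut.conj (innGen s)).toEquiv _ _ fun h => ?_).symm
      have h1 : (innGen s * h * (innGen s)⁻¹)⁻¹ * (innGen s * g) = innGen s * (h⁻¹ * g) := by
        group
      change _ = component K innDegree (innGen s * h * (innGen s)⁻¹) _ ⊗ₜ[K]
        component K innDegree ((innGen s * h * (innGen s)⁻¹)⁻¹ * (innGen s * g)) _
      rw [h1, component_ι_mul, component_gAct]

theorem comul_component (g : Inn X) (x : TV K X) :
    comul χ (component K innDegree g x) = tensorComponent K g (comul χ x) := by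
  classical
  suffices h : comul χ ∘ₗ component K innDegree g = tensorComponent K g ∘ₗ comul χ from
    LinearMap.congr_fun h x
  refine linearMap_ext_word fun u => ?_
  simp only [LinearMap.comp_apply]
  induction u using FreeMonoid.inductionOn' generalizing g with
  | one =>
    have h1 : ∀ h : Inn X, component K innDegree h (1 : TV K X) = if 1 = h then 1 else 0 :=
      fun h => by
        have := component_word (K := K) (X := X) innDegree h 1
        simpa only [map_one] using this
    rw [map_one, comul_one, tensorComponent_tmul,
      Fintype.sum_eq_single (1 : Inn X) fun h hne => by
        rw [h1, if_neg hne.symm, TensorProduct.zero_tmul], h1, h1, h1]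
    by_cases h : 1 = g
    · subst h; simp [comul_one]
    · simp [h]
  | of_mul s u ih =>
    obtain ⟨g, rfl⟩ : ∃ k, g = innGen s * k := ⟨(innGen s)⁻¹ * g, by group⟩
    rw [word_of_mul, component_ι_mul, comul_ι_mul, ih, comul_ι_mul, tensorComponent_primMul]

end InnComponent

/-! ### Stability of the defining ideal under `∂_t` and under the projections. -/

section NicholsIdeal

variable {K : Type*} [Field K] {X : Type*} [Rack X] (χ : X → X → Kˣ)

theorem wordCoeff_eq_zero_of_mem_nicholsIdeal {u : FreeMonoid X} (hu : u.length < 2) {x : TV K X}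
    (hx : x ∈ nicholsIdeal χ) : wordCoeff K u x = 0 := by
  classical
  have : (⨆ n : ℕ, ⨆ _ : 2 ≤ n, (nicholsIdeal χ).restrictScalars K ⊓
      homogeneous K FreeMonoid.length n) ≤ LinearMap.ker (wordCoeff K u) := by
    refine iSup₂_le fun n hn => inf_le_right.trans (Submodule.span_le.2 ?_)
    rintro _ ⟨v, rfl, rfl⟩
    refine (wordCoeff_word u v).trans (if_neg ?_)
    rintro rfl
    exact absurd hn (not_le.2 hu)
  exact this ((isGreatest_nicholsIdeal χ).1.homogeneous hx)

theorem one_notMem_nicholsIdeal : (1 : TV K X) ∉ nicholsIdeal χ := fun h => by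
  have h1 := wordCoeff_eq_zero_of_mem_nicholsIdeal χ (u := 1) (by simp) h
  rw [wordCoeff_one_one] at h1
  exact one_ne_zero h1

/-- Contraction sends `I ⊗ TV` into `I`, and it kills `TV ⊗ I` because elements of `I` have no part
of degree one. -/
theorem skewDer_mem_nicholsIdeal (t : X) {x : TV K X} (hx : x ∈ nicholsIdeal χ) :
    skewDer χ t x ∈ nicholsIdeal χ := by
  set I := (nicholsIdeal χ).restrictScalars K
  have : Submodule.map₂ (TensorProduct.mk K (TV K X) (TV K X)) I ⊤ ⊔
      Submodule.map₂ (TensorProduct.mk K (TV K X) (TV K X)) ⊤ I ≤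
        I.comap (contractRight (wordCoeff K (FreeMonoid.of t))) := by
    refine sup_le (Submodule.map₂_le.2 fun a ha b _ => ?_) (Submodule.map₂_le.2 fun a _ b hb => ?_)
    · rw [Submodule.mem_comap, TensorProduct.mk_apply, contractRight_tmul]
      exact I.smul_mem _ ha
    · rw [Submodule.mem_comap, TensorProduct.mk_apply, contractRight_tmul,
        wordCoeff_eq_zero_of_mem_nicholsIdeal χ (by simp) hb, zero_smul]
      exact zero_mem _
  exact this ((isGreatest_nicholsIdeal χ).1.coideal x hx)

/-- The span of the `Inn X`-homogeneous components of the elements of `nicholsIdeal χ`. -/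
def componentIdeal : Ideal (TV K X) where
  __ := ⨆ g : Inn X, ((nicholsIdeal χ).restrictScalars K).map (component K innDegree g)
  smul_mem' a x hx := by
    set J := ⨆ g : Inn X, ((nicholsIdeal χ).restrictScalars K).map (component K innDegree g)
    change a * x ∈ J
    have ha : a ∈ Submodule.span K (Set.range (word K : FreeMonoid X → TV K X)) := by
      rw [span_word]; trivial
    induction ha using Submodule.span_induction with
    | mem a ha =>
      obtain ⟨u, rfl⟩ := ha
      have : J ≤ J.comap (LinearMap.mulLeft K (word K u)) := by
        refine iSup_le fun g => ?_
        rintro _ ⟨y, hy, rfl⟩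
        refine Submodule.mem_iSup_of_mem (innDegree u * g) ⟨word K u * y, ?_, ?_⟩
        · exact Ideal.mul_mem_left (nicholsIdeal χ) _ hy
        · exact component_word_mul innDegree u g y
      exact this hx
    | zero => rw [zero_mul]; exact zero_mem _
    | add a b _ _ ha hb => rw [add_mul]; exact add_mem ha hb
    | smul r a _ ha => rw [smul_mul_assoc]; exact J.smul_mem r ha

theorem restrictScalars_componentIdeal : (componentIdeal χ).restrictScalars K =
    ⨆ g : Inn X, ((nicholsIdeal χ).restrictScalars K).map (component K innDegree g) := rfl

theorem component_mem_componentIdeal (g : Inn X) {x : TV K X} (hx : x ∈ nicholsIdeal χ) :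
    component K innDegree g x ∈ (componentIdeal χ).restrictScalars K := by
  rw [restrictScalars_componentIdeal]
  exact Submodule.mem_iSup_of_mem g ⟨x, hx, rfl⟩

theorem componentIdeal_isTwoSided : (componentIdeal χ).IsTwoSided := by
  refine ⟨fun {x} b hx => ?_⟩
  set J := (componentIdeal χ).restrictScalars K with hJ
  change x * b ∈ J
  have hb : b ∈ Submodule.span K (Set.range (word K : FreeMonoid X → TV K X)) := by
    rw [span_word]; trivial
  induction hb using Submodule.span_induction with
  | mem b hb =>
    obtain ⟨u, rfl⟩ := hb
    have : J ≤ J.comap (LinearMap.mulRight K (word K u)) := by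
      rw [hJ]
      conv_lhs => rw [restrictScalars_componentIdeal]
      refine iSup_le fun g => ?_
      rintro _ ⟨y, hy, rfl⟩
      change component K innDegree g y * word K u ∈ (componentIdeal χ).restrictScalars K
      rw [← component_mul_word]
      exact component_mem_componentIdeal χ _ (Ideal.mul_mem_right _ (nicholsIdeal χ) hy)
    exact this hx
  | zero => rw [mul_zero]; exact zero_mem _
  | add a b _ _ ha hb => rw [mul_add]; exact add_mem ha hb
  | smul r a _ ha => rw [mul_smul_comm]; exact J.smul_mem r ha

/-- Projecting to an `Inn X`-degree keeps or kills each word, so it respects length, and it is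
compatible with `Δ` by `comul_component`. -/
theorem isNicholsIdeal_componentIdeal [Finite (Inn X)] :
    IsNicholsIdeal χ (componentIdeal χ) where
  isTwoSided := componentIdeal_isTwoSided χ
  homogeneous := by
    conv_lhs => rw [restrictScalars_componentIdeal]
    refine iSup_le fun g => Submodule.map_le_iff_le_comap.2 ?_
    refine (isGreatest_nicholsIdeal χ).1.homogeneous.trans (iSup₂_le fun n hn x hx => ?_)
    exact Submodule.mem_iSup_of_mem n (Submodule.mem_iSup_of_mem hn
      ⟨component_mem_componentIdeal χ g hx.1, component_mem_homogeneous g hx.2⟩)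
  coideal := by
    have := Fintype.ofFinite (Inn X)
    set T := Submodule.map₂ (TensorProduct.mk K (TV K X) (TV K X))
        ((componentIdeal χ).restrictScalars K) ⊤ ⊔
      Submodule.map₂ (TensorProduct.mk K (TV K X) (TV K X)) ⊤
        ((componentIdeal χ).restrictScalars K)
    suffices h : (componentIdeal χ).restrictScalars K ≤ T.comap (comul χ) from fun x hx => h hx
    rw [restrictScalars_componentIdeal]
    refine iSup_le fun g => ?_
    rintro _ ⟨x, hx, rfl⟩
    rw [Submodule.mem_comap, comul_component, tensorComponent, LinearMap.sum_apply]
    refine Submodule.sum_mem _ fun h _ => ?_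
    suffices h : Submodule.map₂ (TensorProduct.mk K (TV K X) (TV K X))
          ((nicholsIdeal χ).restrictScalars K) ⊤ ⊔
        Submodule.map₂ (TensorProduct.mk K (TV K X) (TV K X)) ⊤
          ((nicholsIdeal χ).restrictScalars K) ≤
        T.comap (TensorProduct.map (component K innDegree h) (component K innDegree (h⁻¹ * g)))
      from h ((isGreatest_nicholsIdeal χ).1.coideal x hx)
    refine sup_le (Submodule.map₂_le.2 fun a ha b _ => ?_) (Submodule.map₂_le.2 fun a _ b hb => ?_)
    · exact Submodule.mem_sup_left
        (Submodule.apply_mem_map₂ _ (component_mem_componentIdeal χ h ha) trivial)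
    · exact Submodule.mem_sup_right
        (Submodule.apply_mem_map₂ _ trivial (component_mem_componentIdeal χ _ hb))

/-- The ideal defining the Nichols algebra is `Inn X`-homogeneous. -/
theorem component_mem_nicholsIdeal [Finite (Inn X)] (g : Inn X) {x : TV K X}
    (hx : x ∈ nicholsIdeal χ) : component K innDegree g x ∈ nicholsIdeal χ :=
  (isGreatest_nicholsIdeal χ).2 (isNicholsIdeal_componentIdeal χ)
    (component_mem_componentIdeal χ g hx)

end NicholsIdeal

/-! ### Passage to the quotient and the direct sum decomposition. -/

section NicholsAlgebra

variable {K : Type*} [Field K] {X : Type*} [Rack X] (χ : X → X → Kˣ)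

/-- The quotient map from the tensor algebra to the Nichols algebra. -/
def toNichols : TV K X →ₗ[K] NicholsAlgebra χ :=
  (Ideal.Quotient.mkₐ K (nicholsIdeal χ)).toLinearMap

theorem toNichols_surjective : Function.Surjective (toNichols χ) :=
  Ideal.Quotient.mkₐ_surjective K (nicholsIdeal χ)

theorem toNichols_eq_zero {x : TV K X} : toNichols χ x = 0 ↔ x ∈ nicholsIdeal χ :=
  Ideal.Quotient.eq_zero_iff_mem

theorem exists_nichols_lift (f : Module.End K (TV K X))
    (hf : ∀ x ∈ nicholsIdeal χ, f x ∈ nicholsIdeal χ) :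
    ∃ F : Module.End K (NicholsAlgebra χ), ∀ x, F (toNichols χ x) = toNichols χ (f x) := by
  -- The induced map is defined through a linear section `s`; its choice is irrelevant since `s
  -- (toNichols χ x) - x` lies in the stable ideal.
  obtain ⟨s, hs⟩ := (toNichols χ).exists_rightInverse_of_surjective
    (LinearMap.range_eq_top.2 (toNichols_surjective χ))
  refine ⟨toNichols χ ∘ₗ f ∘ₗ s, fun x => ?_⟩
  have h1 : toNichols χ (s (toNichols χ x)) = toNichols χ x :=
    LinearMap.congr_fun hs (toNichols χ x)
  rw [← sub_eq_zero, ← map_sub, toNichols_eq_zero] at h1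
  have h2 := hf _ h1
  rw [← toNichols_eq_zero, map_sub, map_sub, sub_eq_zero] at h2
  exact h2

theorem iSupIndep_nicholsComponent [Finite (Inn X)] : iSupIndep (nicholsComponent χ) := by
  intro g
  obtain ⟨P, hP⟩ := exists_nichols_lift χ (component K innDegree g)
    fun x hx => component_mem_nicholsIdeal χ g hx
  rw [Submodule.disjoint_def]
  rintro _ ⟨x, hx, rfl⟩ h
  have h1 : (⨆ k, ⨆ _ : k ≠ g, nicholsComponent χ k) ≤ LinearMap.ker P := by
    refine iSup₂_le fun k hk => ?_
    rintro _ ⟨y, hy, rfl⟩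
    change P (toNichols χ y) = 0
    rw [hP, component_of_mem_of_ne hk hy, map_zero]
  have h2 : P (toNichols χ x) = 0 := h1 h
  rw [hP, component_of_mem hx] at h2
  exact h2

theorem iSup_nicholsComponent : ⨆ g, nicholsComponent χ g = ⊤ := by
  change ⨆ g, (homogeneous K innDegree g).map (toNichols χ) = ⊤
  rw [← Submodule.map_iSup, iSup_homogeneous, Submodule.map_top,
    LinearMap.range_eq_top.2 (toNichols_surjective χ)]

end NicholsAlgebra

/-! ### Equality of the dimensions. -/

section Balanced

variable {K : Type*} [Field K] {X : Type*} [Quandle X] {χ : X → X → Kˣ}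

/-- For a generator `g_s` this is the cocycle identity with its last two arguments equal to `t`,
after cancelling `χ(s,t)`. -/
theorem IsCocycle.diag_smul (hχ : IsCocycle χ) (g : Inn X) (t : X) :
    χ (g • t) (g • t) = χ t t := by
  obtain ⟨p, hp⟩ := g
  change χ (p t) (p t) = χ t t
  induction hp using Subgroup.closure_induction generalizing t with
  | mem x hx =>
    obtain ⟨s, rfl⟩ := hx
    have h := hχ s t t
    rw [Quandle.fix, mul_comm] at h
    exact (mul_right_cancel h).symm
  | one => rfl
  | mul x y _ _ hx hy => rw [Equiv.Perm.mul_apply, hx, hy]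
  | inv x _ hx =>
    have h1 := hx (x⁻¹ t)
    have h2 : x (x⁻¹ t) = t := x.apply_symm_apply t
    rw [h2] at h1
    exact h1.symm

theorem IsCocycle.orderOf_diag (hχ : IsCocycle χ) (hX : IsIndecomposable X) (t : X) :
    orderOf (χ t t) = cocycleOrder χ := by
  have h : ∀ s, χ s s = χ t t := fun s => by
    obtain ⟨g, rfl⟩ := hX.exists_smul_eq t s
    exact hχ.diag_smul g t
  rw [cocycleOrder, orderOf_eq_orderOf_iff]
  intro n
  rw [funext_iff]
  simp only [Pi.pow_apply, Pi.one_apply, h]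
  exact ⟨fun hn _ => hn, fun hn => hn t⟩

theorem finrank_nicholsComponent_mul_innGen [Nonempty X] (hX : IsIndecomposable X)
    (hχ : IsCocycle χ) [FiniteDimensional K (NicholsAlgebra χ)]
    (hnm : degree X ∣ cocycleOrder χ) (g : Inn X) (t : X) :
    Module.finrank K (nicholsComponent χ (g * innGen t)) =
      Module.finrank K (nicholsComponent χ g) := by
  have hq : IsPrimitiveRoot (χ t t : K) (cocycleOrder χ) := by
    rw [IsPrimitiveRoot.coe_units_iff, ← hχ.orderOf_diag hX t]
    exact IsPrimitiveRoot.orderOf _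
  have ha : innGen t ^ cocycleOrder χ = 1 :=
    orderOf_dvd_iff_pow_eq_one.1 (by rwa [orderOf_innGen hX])
  obtain ⟨D, hD⟩ := exists_nichols_lift χ (skewDer χ t)
    fun x hx => skewDer_mem_nicholsIdeal χ t hx
  obtain ⟨R, hR⟩ := exists_nichols_lift χ (LinearMap.mulRight K (FreeAlgebra.ι K t))
    fun x hx => Ideal.mul_mem_right _ _ hx
  have hDR : D * R = 1 + (χ t t : K) • (R * D) := by
    refine LinearMap.ext fun x => ?_
    obtain ⟨x, rfl⟩ := toNichols_surjective χ x
    simp only [Module.End.mul_apply, LinearMap.add_apply, LinearMap.smul_apply, hR, hD,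
      LinearMap.mulRight_apply, skewDer_mul_ι, map_add, map_smul, Module.End.one_apply]
  have hv : D (toNichols χ 1) = 0 := by rw [hD, skewDer_one, map_zero]
  have hv0 : toNichols χ 1 ≠ 0 := (toNichols_eq_zero χ).not.2 (one_notMem_nicholsIdeal χ)
  -- Finite dimension excludes the default value `0` of `cocycleOrder χ`.
  obtain ⟨k, hk, hqk⟩ := exists_pow_eq_one_of_lower_raise (χ t t).ne_zero hDR hv hv0
  have hm : 0 < cocycleOrder χ := Nat.pos_of_dvd_of_pos (hq.dvd_of_pow_eq_one k hqk) hk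
  -- If `m = 1`, then `D ^ m = D` is non-zero and the dimension count does not apply; but then `g_t
  -- ^ m = 1` makes `g_t` trivial.
  rcases (Nat.succ_le_iff.2 hm).eq_or_lt with h1 | h1
  · have : innGen t = 1 := by rwa [← h1, pow_one] at ha
    rw [this, mul_one]
  · have hDm : D ^ cocycleOrder χ = 0 := by
      have hDn : ∀ n x, (D ^ n) (toNichols χ x) = toNichols χ ((skewDer χ t ^ n) x) := fun n => by
        induction n with
        | zero => simp
        | succ n ih => intro x; rw [pow_succ, pow_succ, Module.End.mul_apply, hD, ih]; rfl
      refine LinearMap.ext fun x => ?_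
      obtain ⟨x, rfl⟩ := toNichols_surjective χ x
      rw [hDn, skewDer_pow_eq_zero χ t hq h1, LinearMap.zero_apply, map_zero, LinearMap.zero_apply]
    refine finrank_mul_right_eq hq hDR hDm ?_ ?_ ha g
    · rintro h _ ⟨x, hx, rfl⟩
      exact ⟨skewDer χ t x, skewDer_mem_homogeneous χ t hx, (hD x).symm⟩
    · rintro h _ ⟨x, hx, rfl⟩
      exact ⟨x * FreeAlgebra.ι K t, mul_ι_mem_homogeneous t hx, (hR x).symm⟩

theorem eq_of_mul_innGen {X α : Type*} [Rack X] (f : Inn X → α)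
    (hf : ∀ g t, f (g * innGen t) = f g) (g h : Inn X) : f g = f h := by
  suffices key : ∀ g h, f (g * h) = f g by rw [← key g (g⁻¹ * h), mul_inv_cancel_left]
  rintro g ⟨p, hp⟩
  induction hp using Subgroup.closure_induction generalizing g with
  | mem x hx =>
    obtain ⟨s, rfl⟩ := hx
    exact hf g s
  | one => exact congrArg f (mul_one g)
  | mul x y hx hy ihx ihy =>
    exact (congrArg f (mul_assoc g ⟨x, hx⟩ ⟨y, hy⟩).symm).trans ((ihy _).trans (ihx g))
  | inv x hx ih =>
    -- Invariance under `x` is applied at `g x⁻¹`.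
    exact (ih _).symm.trans (congrArg f (inv_mul_cancel_right g (⟨x, hx⟩ : Inn X)))

end Balanced

end RackNichols

end

theorem mainTheorem2 {K : Type*} [Field K] {X : Type*} [Quandle X] [Finite X] [Nonempty X]
    (hX : RackNichols.IsIndecomposable X) (χ : X → X → Kˣ) (hχ : RackNichols.IsCocycle χ)
    (hfin : FiniteDimensional K (RackNichols.NicholsAlgebra χ))
    (hnm : RackNichols.degree X ∣ RackNichols.cocycleOrder χ) :
    RackNichols.IsBalancedGrading (RackNichols.nicholsComponent χ) ∧
      Nat.card (RackNichols.Inn X) ∣ Module.finrank K (RackNichols.NicholsAlgebra χ) := by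
  have hfinrank : ∀ g h, Module.finrank K (RackNichols.nicholsComponent χ g) =
      Module.finrank K (RackNichols.nicholsComponent χ h) :=
    RackNichols.eq_of_mul_innGen (fun g => Module.finrank K (RackNichols.nicholsComponent χ g))
      (RackNichols.finrank_nicholsComponent_mul_innGen hX hχ hnm)
  have hbal : RackNichols.IsBalancedGrading (RackNichols.nicholsComponent χ) :=
    ⟨RackNichols.iSupIndep_nicholsComponent χ, RackNichols.iSup_nicholsComponent χ,
      fun _ => inferInstance, hfinrank⟩
  exact ⟨hbal, _, RackNichols.finrank_eq_card_mul_finrank hbal 1⟩
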